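/- For a real number $x$ let $\Vert x\Vert$ denote its distance to the nearest integer. For $\zeta\in\mathbb{R}$ let $\lambda_1(\zeta)\in[-\infty,\infty]$ be the supremum of all real $\mu$ such that $\Vert x\zeta\Vert\le x^{-\mu}$ has arbitrarily large integer solutions $x$. For $\underline{\zeta}=(\zeta_1,\ldots,\zeta_k)\in\mathbb{R}^k$ let $\chi_k(\underline{\zeta})\in[-\infty,\infty]$ be the supremum of all real $\nu>0$ such that, for arbitrarily large real $X$, there exists $(x_1,\ldots,x_k)\in\mathbb{Z}^k$ with \[ 0<\min_{1\le j\le k}|x_j|\le\max_{1\le j\le k}|x_j|\le X,\qquad \max_{1\le j\le k}\Vert x_j\zeta_j\Vert\le X^{-\nu}. \] Let $k\ge 2$ be an integer and let $\lambda_1,\ldots,\lambda_k,w$ be real numbers with $1\le w\le\min_{1\le j\le k}\lambda_j$. Then there exist uncountably many vectors $(\zeta_1,\ldots,\zeta_k)\in\mathbb{R}^k$ such that $1,\zeta_1,\ldots,\zeta_k$ are linearly independent over $\mathbb{Q}$, $\lambda_1(\zeta_j)=\lambda_j$ for every $1\le j\le k$, and $\chi_k(\zeta_1,\ldots,\zeta_k)=w$.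 -/

import Mathlib

open Filter

/-- The distance `‖x‖` of a real number to the nearest integer. -/
noncomputable def distInt (x : ℝ) : ℝ := |x - round x|

/-- The classical exponent `λ₁(ζ)`: the supremum in `[-∞, ∞]` of all real `μ` such that
`‖x ζ‖ ≤ x ^ (-μ)` has arbitrarily large integer solutions `x`. -/
noncomputable def lambdaOne (ζ : ℝ) : EReal :=
  sSup {e : EReal | ∃ μ : ℝ, e = (μ : EReal) ∧
    ∃ᶠ x : ℕ in atTop, distInt ((x : ℝ) * ζ) ≤ (x : ℝ) ^ (-μ)}

/-- The set of `ζ ∈ ℝ ^ k` such that, for arbitrarily large real `X`, there are integers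
`x₁, …, x_k` with `0 < min |x_j|`, `max |x_j| ≤ X` and `max ‖x_j ζ_j‖ ≤ ψ X`. -/
def chiSet (k : ℕ) (ψ : ℝ → ℝ) : Set (Fin k → ℝ) :=
  {ζ | ∃ᶠ X : ℝ in atTop, ∃ x : Fin k → ℤ,
    ∀ j, 0 < |x j| ∧ (|x j| : ℝ) ≤ X ∧ distInt ((x j : ℝ) * ζ j) ≤ ψ X}

/-- The exponent `χ_k(ζ)`: the supremum in `[-∞, ∞]` of all real `ν > 0` such that `ζ` belongs to
`chiSet k ψ` for `ψ t = t ^ (-ν)`. -/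
noncomputable def chiExponent (k : ℕ) (ζ : Fin k → ℝ) : EReal :=
  sSup {e : EReal | ∃ ν : ℝ, e = (ν : EReal) ∧ 0 < ν ∧ ζ ∈ chiSet k (fun t : ℝ => t ^ (-ν))}

/-!
Gluing Farey neighbours gives fractions `p n / q n` with `p (n + 1) * q n - p n * q (n + 1) = 1`
and `q n` within a factor `2` of any prescribed sequence of scales growing by a factor `8`. At each
step two neighbours with disjoint admissible intervals are available, so the limit can be made to
avoid any countable set. This limit `z` satisfies `‖q n z‖ ≍ 1 / q (n + 1)`, and
`‖x z‖ ≫ 1 / q n` whenever `0 < |x| < q n`. Taking as scales the powers of `8`, except that the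
exponent `u i` is followed by about `lam * u i`, produces uncountably many `z` with
`lambdaOne z = lam` all of whose good approximations come from the jumps at the `8 ^ u i`.

For the theorem, one coordinate, with exponent `α`, has its jumps at a sparse sequence `t` and all
others at `s` with `s i ≈ α * t i / w`. For `X ≈ 8 ^ s i` all coordinates are then approximated to
within about `X ^ (-w)`. Conversely, if `ν > w` and `‖x z‖ ≤ X ^ (-ν)` is solvable with `|x| ≤ X`
for the first coordinate and for another one, of exponent `β`, the denominators come from jumps at
some `t a` and `s b`: both `8 ^ t a` and `8 ^ s b` are at most `X`, while `X ^ ν` is at most a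
multiple of `8 ^ (α * t a)` and of `8 ^ (β * s b)`. The second bound forces `a ≤ b`, as the
`t i` with `i > b` are much larger than `β * s b`; then `α * t a ≤ w * s a ≤ w * s b`, so the first
bound gives `X ^ ν ≪ X ^ w`. Linear independence over `ℚ` only excludes countably many values of
each successive coordinate.
-/

/-! ### Farey chains -/

/-- The integer fractions `p n / q n` increase, consecutive ones are Farey neighbours, and the
denominators grow at least by a factor `4`. -/
structure FareyChain (p q : ℕ → ℤ) : Prop where
  pos : ∀ n, 0 < q n
  det : ∀ n, p (n + 1) * q n - p n * q (n + 1) = 1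
  growth : ∀ n, 4 * q n ≤ q (n + 1)

namespace FareyChain

variable {p q : ℕ → ℤ} (h : FareyChain p q)

include h

lemma isCoprime (n : ℕ) : IsCoprime (p n) (q n) :=
  ⟨-q (n + 1), p (n + 1), by linear_combination h.det n⟩

lemma cast_pos (n : ℕ) : (0 : ℝ) < q n := by exact_mod_cast h.pos n

lemma cast_growth (n : ℕ) : (4 * q n : ℝ) ≤ q (n + 1) := by exact_mod_cast h.growth n

lemma div_succ (n : ℕ) : (p (n + 1) / q (n + 1) : ℝ) = p n / q n + 1 / (q n * q (n + 1)) := by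
  have hdet : (p (n + 1) * q n - p n * q (n + 1) : ℝ) = 1 := by exact_mod_cast h.det n
  have := h.cast_pos n
  have := h.cast_pos (n + 1)
  field_simp
  linear_combination hdet

lemma monotone_div : Monotone fun n ↦ (p n / q n : ℝ) := by
  refine monotone_nat_of_le_succ fun n ↦ ?_
  have := h.cast_pos n
  have := h.cast_pos (n + 1)
  rw [h.div_succ n]
  exact le_add_of_nonneg_right (by positivity)

lemma antitone_div_add : Antitone fun n ↦ (p n / q n + 2 / (q n * q (n + 1)) : ℝ) := by
  refine antitone_nat_of_succ_le fun n ↦ ?_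
  have h₀ := h.cast_pos n
  have h₁ := h.cast_pos (n + 1)
  have h₂ := h.cast_pos (n + 2)
  have hq : (2 * q n : ℝ) ≤ q (n + 2) := by linarith [h.cast_growth n, h.cast_growth (n + 1)]
  have htail : (2 / (q (n + 1) * q (n + 2)) : ℝ) ≤ 1 / (q n * q (n + 1)) := by
    rw [div_le_div_iff₀ (by positivity) (by positivity)]
    linarith [mul_le_mul_of_nonneg_right hq h₁.le]
  calc (p (n + 1) / q (n + 1) + 2 / (q (n + 1) * q (n + 2)) : ℝ)
      ≤ p n / q n + 1 / (q n * q (n + 1)) + 1 / (q n * q (n + 1)) := by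
        rw [h.div_succ n]; gcongr
    _ = p n / q n + 2 / (q n * q (n + 1)) := by ring

lemma exists_limit : ∃ z : ℝ, ∀ n, q n * z - p n ∈ Set.Icc (0 : ℝ) (2 / q (n + 1)) := by
  have hle (n : ℕ) : (p n / q n : ℝ) ≤ p n / q n + 2 / (q n * q (n + 1)) := by
    have := h.cast_pos n
    have := h.cast_pos (n + 1)
    exact le_add_of_nonneg_right (by positivity)
  refine ⟨⨆ n, (p n / q n : ℝ), fun n ↦ ?_⟩
  have hz := h.monotone_div.ciSup_mem_iInter_Icc_of_antitone h.antitone_div_add hle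
  obtain ⟨hlow, hupp⟩ := Set.mem_iInter.1 hz n
  have hpos := h.cast_pos n
  rw [div_le_iff₀' hpos] at hlow
  rw [← div_div, div_right_comm, ← add_div, le_div_iff₀' hpos] at hupp
  exact ⟨sub_nonneg.2 hlow, sub_le_iff_le_add'.2 hupp⟩

end FareyChain

lemma one_div_two_mul_le_distInt {p q x : ℤ} {z : ℝ} (hpq : IsCoprime p q) (hx : x ≠ 0)
    (hxq : |x| < q) (hz : |q * z - p| ≤ 1 / (2 * q)) : 1 / (2 * q) ≤ distInt (x * z) := by
  set y := round (x * z)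
  have hq : (0 : ℝ) < q := by exact_mod_cast (abs_nonneg x).trans_lt hxq
  have hne : x * p - y * q ≠ 0 := fun h0 ↦ by
    have hdvd : q ∣ x := hpq.symm.dvd_of_dvd_mul_right ⟨y, by linear_combination h0⟩
    exact hxq.not_ge (Int.le_of_dvd (abs_pos.2 hx) ((dvd_abs _ _).2 hdvd))
  have hone : 1 ≤ |(x * p - y * q : ℝ)| := by exact_mod_cast Int.one_le_abs hne
  have herr : |x * (q * z - p)| ≤ 1 / 2 := by
    have hxq' : |(x : ℝ)| ≤ q := by exact_mod_cast hxq.le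
    calc |x * (q * z - p)| = |(x : ℝ)| * |q * z - p| := abs_mul _ _
      _ ≤ q * (1 / (2 * q)) := by gcongr
      _ = 1 / 2 := by field_simp
  have htri : |(x * p - y * q : ℝ)| ≤ q * |x * z - y| + |x * (q * z - p)| := by
    calc |(x * p - y * q : ℝ)| = |q * (x * z - y) - x * (q * z - p)| := by ring_nf
      _ ≤ |q * (x * z - y)| + |x * (q * z - p)| := abs_sub _ _
      _ = q * |x * z - y| + |x * (q * z - p)| := by rw [abs_mul, abs_of_pos hq]
  change _ ≤ |x * z - y|
  rw [div_le_iff₀' (by positivity)]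
  linarith

/-! ### Prescribing the denominators -/

lemma exists_farey_neighbour {p q : ℤ} (hq : 0 < q) (hpq : IsCoprime p q) (T : ℤ) :
    ∃ p' q' : ℤ, T ≤ q' ∧ q' < T + q ∧ p' * q - p * q' = 1 := by
  obtain ⟨v, u, huv⟩ := hpq
  obtain ⟨s, ⟨hs, hs'⟩, -⟩ := existsUnique_add_zsmul_mem_Ico hq (-v) T
  rw [smul_eq_mul] at hs hs'
  exact ⟨u + s * p, -v + s * q, hs, hs', by linear_combination huv⟩

lemma exists_farey_neighbour_notMem_Icc {p q T : ℤ} (hq : 0 < q) (hpq : IsCoprime p q)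
    (hT : 2 * q ≤ T) (c : ℝ) : ∃ p' q' : ℤ, T ≤ q' ∧ q' ≤ 2 * T ∧ p' * q - p * q' = 1 ∧
      q' * c - p' ∉ Set.Icc (0 : ℝ) (1 / q') := by
  obtain ⟨p', q', hTq', hq'T, hdet⟩ := exists_farey_neighbour hq hpq T
  by_cases hc : q' * c - p' ∈ Set.Icc (0 : ℝ) (1 / q')
  · refine ⟨p' + p, q' + q, by lia, by lia, by linear_combination hdet, fun hshift ↦ ?_⟩
    push_cast at hshift
    -- With `e = q' * c - p'` and `f = (q' + q) * c - (p' + p)` one has `q' * f = (q' + q) * e + 1`,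
    -- which rules out `0 ≤ e` and `(q' + q) * f ≤ 1` holding together.
    have hqR : (0 : ℝ) < q := by exact_mod_cast hq
    have hq'R : (0 : ℝ) < q' := by exact_mod_cast (by lia : 0 < q')
    have hdetR : (p' * q - p * q' : ℝ) = 1 := by exact_mod_cast hdet
    have hle : (q' + q) * ((q' + q) * c - (p' + p)) ≤ (1 : ℝ) :=
      (le_div_iff₀' (by positivity)).1 hshift.2
    have hge : (1 : ℝ) ≤ q' * ((q' + q) * c - (p' + p)) := by
      linarith [mul_nonneg (add_nonneg hq'R.le hqR.le) hc.1]
    nlinarith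
  · exact ⟨p', q', hTq', by lia, hdet, hc⟩

lemma exists_fareyChain {Q : ℕ → ℕ} (hQ₀ : 0 < Q 0) (hQ : ∀ n, 8 * Q n ≤ Q (n + 1))
    (c : ℕ → ℝ) : ∃ p q : ℕ → ℤ, FareyChain p q ∧ (∀ n, Q n ≤ q n ∧ q n ≤ 2 * Q n) ∧
      ∀ n, q (n + 1) * c n - p (n + 1) ∉ Set.Icc (0 : ℝ) (1 / q (n + 1)) := by
  have hQpos (n : ℕ) : 0 < Q n := by
    induction n with
    | zero => exact hQ₀
    | succ n ih => have := hQ n; lia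
  have step (n : ℕ) (f : ℤ × ℤ)
      (hf : ((Q n : ℤ) ≤ f.2 ∧ f.2 ≤ 2 * Q n) ∧ IsCoprime f.1 f.2) :
      ∃ f' : ℤ × ℤ, ((Q (n + 1) : ℤ) ≤ f'.2 ∧ f'.2 ≤ 2 * Q (n + 1)) ∧
        f'.1 * f.2 - f.1 * f'.2 = 1 ∧ f'.2 * c n - f'.1 ∉ Set.Icc (0 : ℝ) (1 / f'.2) := by
    have := hQ n
    have := hQpos n
    obtain ⟨p', q', hle, hle', hdet, hc⟩ :=
      exists_farey_neighbour_notMem_Icc (T := Q (n + 1)) (by lia) hf.2 (by lia) (c n)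
    exact ⟨(p', q'), ⟨hle, hle'⟩, hdet, hc⟩
  choose! next hnext using step
  let f (n : ℕ) : ℤ × ℤ := Nat.rec (1, Q 0) next n
  have hf (n : ℕ) : ((Q n : ℤ) ≤ (f n).2 ∧ (f n).2 ≤ 2 * Q n) ∧ IsCoprime (f n).1 (f n).2 := by
    induction n with
    | zero => exact ⟨⟨le_rfl, by change (Q 0 : ℤ) ≤ _; lia⟩, isCoprime_one_left⟩
    | succ n ih =>
      obtain ⟨hle, hdet, -⟩ := hnext n (f n) ih
      exact ⟨hle, (f n).2, -(f n).1, by linear_combination hdet⟩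
  refine ⟨fun n ↦ (f n).1, fun n ↦ (f n).2, ⟨fun n ↦ ?_, fun n ↦ (hnext n _ (hf n)).2.1,
    fun n ↦ ?_⟩, fun n ↦ (hf n).1, fun n ↦ (hnext n _ (hf n)).2.2⟩
  · have := (hf n).1
    have := hQpos n
    lia
  · have := (hf n).1
    have := (hf (n + 1)).1
    have := hQ n
    lia

/-- The denominators of the good rational approximations of `z` are governed by the scales `Q n`:
some denominator in `[Q n, 2 * Q n]` has error `O(1 / Q (n + 1))`, and denominators below `Q n` have
error `≫ 1 / Q n`. -/
structure HasScales (Q : ℕ → ℕ) (z : ℝ) : Prop where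
  exists_distInt_le : ∀ n, ∃ x : ℕ, Q n ≤ x ∧ x ≤ 2 * Q n ∧ distInt (x * z) ≤ 2 / Q (n + 1)
  le_distInt : ∀ n (x : ℤ), x ≠ 0 → |x| < Q n → 1 / (4 * Q n) ≤ distInt (x * z)

lemma exists_hasScales_forall_ne {Q : ℕ → ℕ} (hQ₀ : 0 < Q 0) (hQ : ∀ n, 8 * Q n ≤ Q (n + 1))
    (c : ℕ → ℝ) : ∃ z, HasScales Q z ∧ ∀ n, z ≠ c n := by
  obtain ⟨p, q, h, hqQ, hc⟩ := exists_fareyChain hQ₀ hQ c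
  obtain ⟨z, hz⟩ := h.exists_limit
  have hqQ' (n : ℕ) : (Q n : ℝ) ≤ q n ∧ (q n : ℝ) ≤ 2 * Q n := by exact_mod_cast hqQ n
  have hQpos (n : ℕ) : (0 : ℝ) < Q n := by linarith [h.cast_pos n, (hqQ' n).2]
  refine ⟨z, ⟨fun n ↦ ?_, fun n x hx hxQ ↦ ?_⟩, ?_⟩
  · refine ⟨(q n).toNat, by have := hqQ n; lia, by have := hqQ n; lia, ?_⟩
    have hcast : (((q n).toNat : ℕ) : ℝ) = q n := by
      exact_mod_cast Int.toNat_of_nonneg (h.pos n).le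
    calc distInt ((q n).toNat * z) ≤ |q n * z - p n| := by rw [hcast]; exact round_le _ _
      _ = q n * z - p n := abs_of_nonneg (hz n).1
      _ ≤ 2 / q (n + 1) := (hz n).2
      _ ≤ 2 / Q (n + 1) := by gcongr; exacts [hQpos _, (hqQ' _).1]
  · have hclose : |q n * z - p n| ≤ 1 / (2 * q n) := by
      have := h.cast_pos n
      have := h.cast_growth n
      rw [abs_of_nonneg (hz n).1]
      refine (hz n).2.trans ?_
      rw [div_le_div_iff₀ (by linarith) (by linarith)]
      linarith
    calc (1 / (4 * Q n) : ℝ) ≤ 1 / (2 * q n) := by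
          have := h.cast_pos n
          exact one_div_le_one_div_of_le (by positivity) (by linarith [(hqQ' n).2])
      _ ≤ distInt (x * z) :=
        one_div_two_mul_le_distInt (h.isCoprime n) hx (hxQ.trans_le (hqQ n).1) hclose
  · rintro n rfl
    have := h.cast_pos (n + 1)
    have := h.cast_growth (n + 1)
    refine hc n ⟨(hz (n + 1)).1, (hz (n + 1)).2.trans ?_⟩
    rw [div_le_div_iff₀ (by linarith) (by linarith)]
    linarith

lemma not_countable_setOf_hasScales {Q : ℕ → ℕ} (hQ₀ : 0 < Q 0) (hQ : ∀ n, 8 * Q n ≤ Q (n + 1)) :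
    ¬ {z | HasScales Q z}.Countable := by
  intro hcount
  obtain ⟨z₀, hz₀, -⟩ := exists_hasScales_forall_ne hQ₀ hQ 0
  obtain ⟨c, hc⟩ := hcount.exists_eq_range ⟨z₀, hz₀⟩
  obtain ⟨z, hz, hne⟩ := exists_hasScales_forall_ne hQ₀ hQ c
  obtain ⟨n, rfl⟩ : z ∈ Set.range c := hc ▸ hz
  exact hne n rfl

/-! ### Sparse sequences of gaps -/

/-- The sequence of exponents `u` leaves room for a jump from `u i` to `lam * u i`, rounded up,
before `u (i + 1)`. -/
def IsSparse (lam : ℝ) (u : ℕ → ℕ) : Prop := ∀ i, lam * u i + 1 ≤ u (i + 1)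

lemma IsSparse.strictMono {lam : ℝ} {u : ℕ → ℕ} (hlam : 1 ≤ lam) (hu : IsSparse lam u) :
    StrictMono u := by
  refine strictMono_nat_of_lt_succ fun i ↦ ?_
  have hle : (u i : ℝ) ≤ lam * u i := le_mul_of_one_le_left (Nat.cast_nonneg _) hlam
  have hlt : (u i : ℝ) < u (i + 1) := by linarith [hu i]
  exact_mod_cast hlt

open Classical in
/-- The successor of `m` in the sequence of exponents `gapScale lam u`: about `lam * m` if `m` is a
value of `u`, and `m + 1` otherwise. -/
noncomputable def gapJump (lam : ℝ) (u : ℕ → ℕ) (m : ℕ) : ℕ :=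
  if m ∈ Set.range u then ⌊lam * m⌋₊ + 1 else m + 1

/-- The sequence of all exponents starting with `0`, except that each value `m` of `u` is followed
by a jump to about `lam * m`. -/
noncomputable def gapScale (lam : ℝ) (u : ℕ → ℕ) (n : ℕ) : ℕ := (gapJump lam u)^[n] 0

section gapScale

variable {lam : ℝ} {u : ℕ → ℕ}

lemma gapJump_of_notMem {m : ℕ} (hm : m ∉ Set.range u) : gapJump lam u m = m + 1 := if_neg hm

lemma gapJump_apply (i : ℕ) : gapJump lam u (u i) = ⌊lam * u i⌋₊ + 1 := if_pos ⟨i, rfl⟩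

lemma le_gapJump_apply (i : ℕ) : lam * u i ≤ gapJump lam u (u i) := by
  rw [gapJump_apply]
  exact_mod_cast (Nat.lt_floor_add_one _).le

lemma gapJump_apply_le (hlam : 0 ≤ lam) (i : ℕ) : gapJump lam u (u i) ≤ lam * u i + 1 := by
  rw [gapJump_apply]
  push_cast
  gcongr
  exact Nat.floor_le (by positivity)

lemma lt_gapJump (hlam : 1 ≤ lam) (m : ℕ) : m < gapJump lam u m := by
  by_cases hm : m ∈ Set.range u
  · obtain ⟨i, rfl⟩ := hm
    rw [gapJump_apply, Nat.lt_succ_iff]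
    exact Nat.le_floor (le_mul_of_one_le_left (Nat.cast_nonneg _) hlam)
  · exact gapJump_of_notMem hm ▸ m.lt_succ_self

lemma gapJump_le_of_lt (hlam : 1 ≤ lam) (hu : IsSparse lam u) {m i : ℕ} (hm : m < u i) :
    gapJump lam u m ≤ u i := by
  by_cases hmu : m ∈ Set.range u
  · obtain ⟨i', rfl⟩ := hmu
    have hmono := hu.strictMono hlam
    have hsucc : u (i' + 1) ≤ u i := hmono.monotone (hmono.lt_iff_lt.1 hm)
    have hle : (gapJump lam u (u i') : ℝ) ≤ u (i' + 1) :=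
      (gapJump_apply_le (zero_le_one.trans hlam) i').trans (hu i')
    exact (Nat.cast_le.1 hle).trans hsucc
  · exact gapJump_of_notMem hmu ▸ hm

lemma gapScale_succ (n : ℕ) : gapScale lam u (n + 1) = gapJump lam u (gapScale lam u n) :=
  Function.iterate_succ_apply' _ _ _

lemma strictMono_gapScale (hlam : 1 ≤ lam) : StrictMono (gapScale lam u) :=
  strictMono_nat_of_lt_succ fun n ↦ gapScale_succ (u := u) n ▸ lt_gapJump hlam _

lemma exists_mem_Ico_gapScale (hlam : 1 ≤ lam) (m : ℕ) :
    ∃ n, m ∈ Set.Ico (gapScale lam u n) (gapScale lam u (n + 1)) := by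
  have hmono := strictMono_gapScale (u := u) hlam
  have hunion := iUnion_Ico_map_succ_eq_Ici (fun n ↦ hmono.monotone (bot_le (a := n)))
    hmono.not_bddAbove_range_of_isSuccArchimedean
  exact Set.mem_iUnion.1 (hunion ▸ Set.mem_Ici.2 (Nat.zero_le m))

lemma exists_gapScale_eq (hlam : 1 ≤ lam) (hu : IsSparse lam u) (i : ℕ) :
    ∃ n, gapScale lam u n = u i := by
  obtain ⟨n, hle, hlt⟩ := exists_mem_Ico_gapScale (u := u) hlam (u i)
  refine ⟨n, hle.antisymm (not_lt.1 fun h ↦ hlt.not_ge ?_)⟩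
  rw [gapScale_succ]
  exact gapJump_le_of_lt hlam hu h

end gapScale

/-- `z` has approximations of exponent about `lam` with denominators about `8 ^ u i`, and every
denominator for which `z` is not badly approximable comes after some `8 ^ u i`, with an error not
much smaller than `8 ^ (-lam * u i)`. -/
structure HasGaps (lam : ℝ) (u : ℕ → ℕ) (z : ℝ) : Prop where
  exists_distInt_le : ∀ i, ∃ x : ℕ, 8 ^ u i ≤ x ∧ x ≤ 8 ^ (u i + 1) ∧
    distInt (x * z) ≤ 8 ^ (1 - lam * u i)
  le_distInt : ∀ x : ℤ, x ≠ 0 → (8 : ℝ) ^ (-2 : ℝ) / |(x : ℝ)| ≤ distInt (x * z) ∨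
    ∃ i, (8 : ℝ) ^ u i ≤ |(x : ℝ)| ∧ (8 : ℝ) ^ (-(lam * u i + 2)) ≤ distInt (x * z)

lemma exists_pow_gapScale_le_abs_lt {lam : ℝ} (hlam : 1 ≤ lam) (u : ℕ → ℕ) {x : ℤ} (hx : x ≠ 0) :
    ∃ n, 8 ^ gapScale lam u n ≤ |x| ∧ |x| < 8 ^ gapScale lam u (n + 1) := by
  obtain ⟨n, hle, hlt⟩ := exists_mem_Ico_gapScale (u := u) hlam (Nat.log 8 x.natAbs)
  have hlow := Nat.pow_le_of_le_log (Int.natAbs_ne_zero.2 hx) hle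
  have hupp := Nat.lt_pow_of_log_lt (by norm_num) hlt
  rw [Int.abs_eq_natAbs]
  exact ⟨n, by exact_mod_cast hlow, by exact_mod_cast hupp⟩

lemma HasScales.hasGaps {lam : ℝ} {u : ℕ → ℕ} {z : ℝ} (hlam : 1 ≤ lam) (hu : IsSparse lam u)
    (h : HasScales (fun n ↦ 8 ^ gapScale lam u n) z) : HasGaps lam u z where
  exists_distInt_le i := by
    obtain ⟨n, hn⟩ := exists_gapScale_eq hlam hu i
    obtain ⟨x, hlow, hupp, hdist⟩ := h.exists_distInt_le n
    simp only [gapScale_succ, hn, Nat.cast_pow, Nat.cast_ofNat] at hlow hupp hdist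
    refine ⟨x, hlow, hupp.trans (by rw [pow_succ']; gcongr; norm_num), hdist.trans ?_⟩
    rw [Real.rpow_sub (by norm_num), Real.rpow_one, ← Real.rpow_natCast]
    gcongr
    · norm_num
    · norm_num
    · exact le_gapJump_apply i
  le_distInt x hx := by
    obtain ⟨n, hlow, hupp⟩ := exists_pow_gapScale_le_abs_lt hlam u hx
    have hlow' : (8 : ℝ) ^ gapScale lam u n ≤ |(x : ℝ)| := by exact_mod_cast hlow
    have hdist := h.le_distInt (n + 1) x hx (by exact_mod_cast hupp)
    rw [gapScale_succ] at hdist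
    push_cast at hdist
    by_cases hn : gapScale lam u n ∈ Set.range u
    · obtain ⟨i, hi⟩ := hn
      rw [← hi] at hlow' hdist
      refine .inr ⟨i, hlow', le_trans ?_ hdist⟩
      calc (8 : ℝ) ^ (-(lam * u i + 2)) = 1 / (8 * 8 ^ (lam * u i + 1)) := by
            rw [Real.rpow_neg (by norm_num), one_div, ← Real.rpow_one_add' (by norm_num)]
            · ring_nf
            · positivity
        _ ≤ 1 / (4 * 8 ^ gapJump lam u (u i)) := by
            rw [← Real.rpow_natCast]
            gcongr
            · norm_num
            · norm_num
            · exact gapJump_apply_le (by linarith) i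
    · refine .inl (le_trans ?_ hdist)
      have : (0 : ℝ) < 8 ^ gapScale lam u n := by positivity
      rw [gapJump_of_notMem hn, pow_succ, Real.rpow_neg (by norm_num),
        div_le_div_iff₀ (by linarith) (by positivity)]
      norm_num
      linarith

lemma not_countable_setOf_hasGaps {lam : ℝ} {u : ℕ → ℕ} (hlam : 1 ≤ lam) (hu : IsSparse lam u) :
    ¬ {z | HasGaps lam u z}.Countable := by
  refine fun hc ↦ not_countable_setOf_hasScales (Q := fun n ↦ 8 ^ gapScale lam u n)
    (by positivity) (fun n ↦ ?_) (hc.mono fun z hz ↦ hz.hasGaps hlam hu)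
  rw [← pow_succ']
  exact Nat.pow_le_pow_right (by norm_num) (strictMono_gapScale hlam n.lt_succ_self)

/-! ### Exponents -/

lemma sSup_setOf_coe_eq {P : ℝ → Prop} {a : ℝ} (ha : 0 < a) (hle : ∀ μ, P μ → μ ≤ a)
    (hlt : ∀ μ, 0 < μ → μ < a → P μ) :
    sSup {e : EReal | ∃ μ : ℝ, e = (μ : EReal) ∧ P μ} = a := by
  refine le_antisymm (sSup_le ?_) (le_of_forall_lt fun c hc ↦ ?_)
  · rintro _ ⟨μ, rfl, hμ⟩
    exact_mod_cast hle μ hμ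
  · have hmax : max c 0 < (a : EReal) := max_lt hc (by exact_mod_cast ha)
    obtain ⟨μ, hcμ, hμa⟩ := EReal.lt_iff_exists_real_btwn.1 hmax
    obtain ⟨hcμ, hμ⟩ := max_lt_iff.1 hcμ
    exact hcμ.trans_le (le_sSup ⟨μ, rfl, hlt μ (by exact_mod_cast hμ) (by exact_mod_cast hμa)⟩)

lemma eventually_lt_mul_logb {b c : ℝ} (hb : 1 < b) (hc : 0 < c) (B : ℝ) :
    ∀ᶠ X in atTop, B < c * Real.logb b X :=
  ((Real.tendsto_logb_atTop hb).const_mul_atTop hc).eventually_gt_atTop B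

lemma eventually_le_mul_natCast {u : ℕ → ℕ} (hu : StrictMono u) {c : ℝ} (hc : 0 < c) (B : ℝ) :
    ∀ᶠ i in atTop, B ≤ c * u i :=
  ((tendsto_natCast_atTop_atTop.comp hu.tendsto_atTop).const_mul_atTop hc).eventually_ge_atTop B

namespace HasGaps

variable {lam z : ℝ} {u : ℕ → ℕ}

lemma exists_of_distInt_le {ν X : ℝ} (h : HasGaps lam u z) (hX : 2 < (ν - 1) * Real.logb 8 X)
    {x : ℤ} (hx : x ≠ 0) (hxX : |(x : ℝ)| ≤ X) (hd : distInt (x * z) ≤ X ^ (-ν)) :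
    ∃ i, u i ≤ Real.logb 8 X ∧ ν * Real.logb 8 X ≤ lam * u i + 2 := by
  have hx₀ : 0 < |(x : ℝ)| := by positivity
  have hX₀ : 0 < X := hx₀.trans_le hxX
  have hlog : (8 : ℝ) ^ Real.logb 8 X = X := Real.rpow_logb (by norm_num) (by norm_num) hX₀
  set A := Real.logb 8 X
  rw [← hlog, ← Real.rpow_mul (by norm_num)] at hd
  obtain hbad | ⟨i, hi, hgap⟩ := h.le_distInt x hx
  · have hle : (8 : ℝ) ^ (-2 - A) ≤ 8 ^ (A * -ν) := by
      refine le_trans ?_ (hbad.trans hd)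
      rw [Real.rpow_sub (by norm_num), hlog]
      gcongr
    have := (Real.rpow_le_rpow_left_iff (by norm_num)).1 hle
    linarith
  · refine ⟨i, ?_, ?_⟩
    · rw [Real.le_logb_iff_rpow_le (by norm_num) hX₀, Real.rpow_natCast]
      exact hi.trans hxX
    · have := (Real.rpow_le_rpow_left_iff (by norm_num)).1 (hgap.trans hd)
      linarith

lemma exists_distInt_le_rpow {ν : ℝ} {a i : ℕ} (h : HasGaps lam u z) (ha : u i < a)
    (hν : ν * a ≤ lam * u i - 1) :
    ∃ x : ℕ, 8 ^ u i ≤ x ∧ x ≤ 8 ^ a ∧ distInt (x * z) ≤ ((8 : ℝ) ^ a) ^ (-ν) := by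
  obtain ⟨x, hlow, hupp, hd⟩ := h.exists_distInt_le i
  refine ⟨x, hlow, hupp.trans (Nat.pow_le_pow_right (by norm_num) ha), hd.trans ?_⟩
  rw [← Real.rpow_natCast, ← Real.rpow_mul (by norm_num)]
  gcongr
  · norm_num
  · linarith

lemma le_of_frequently_distInt_le {μ : ℝ} (hlam : 1 ≤ lam) (h : HasGaps lam u z)
    (hμ : ∃ᶠ x : ℕ in atTop, distInt (x * z) ≤ (x : ℝ) ^ (-μ)) : μ ≤ lam := by
  by_contra! hlt
  have hlarge : ∀ᶠ x : ℕ in atTop, 2 < (μ - lam) * Real.logb 8 x :=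
    tendsto_natCast_atTop_atTop.eventually
      (eventually_lt_mul_logb (by norm_num) (sub_pos.2 hlt) 2)
  obtain ⟨x, hd, hx, hx₀⟩ := (hμ.and_eventually (hlarge.and (eventually_gt_atTop 0))).exists
  have hlog : 0 < Real.logb 8 x := pos_of_mul_pos_right (by linarith) (sub_nonneg.2 hlt.le)
  have hx' : 2 < (μ - 1) * Real.logb 8 x := hx.trans_le (by gcongr)
  obtain ⟨i, hi, hμi⟩ := h.exists_of_distInt_le hx' (x := x) (by exact_mod_cast hx₀.ne')
    (by simp) (by exact_mod_cast hd)
  have := mul_le_mul_of_nonneg_left hi (zero_le_one.trans hlam)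
  linarith

lemma frequently_distInt_le {μ : ℝ} (hu : StrictMono u) (h : HasGaps lam u z) (hμ₀ : 0 ≤ μ)
    (hμ : μ < lam) : ∃ᶠ x : ℕ in atTop, distInt (x * z) ≤ (x : ℝ) ^ (-μ) := by
  refine frequently_atTop.2 fun N ↦ ?_
  obtain ⟨i, hi, hNi⟩ := ((eventually_le_mul_natCast hu (sub_pos.2 hμ) (μ + 1)).and
    (hu.tendsto_atTop.eventually_ge_atTop N)).exists
  obtain ⟨x, hlow, hupp, hd⟩ := h.exists_distInt_le_rpow (ν := μ) (u i).lt_succ_self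
    (by push_cast; linarith)
  have hx : u i < x := (Nat.lt_pow_self (by norm_num)).trans_le hlow
  refine ⟨x, hNi.trans hx.le, hd.trans ?_⟩
  exact Real.rpow_le_rpow_of_nonpos (by exact_mod_cast (Nat.zero_le _).trans_lt hx)
    (by exact_mod_cast hupp) (neg_nonpos.2 hμ₀)

theorem lambdaOne_eq (hlam : 1 ≤ lam) (hu : StrictMono u) (h : HasGaps lam u z) :
    lambdaOne z = lam :=
  sSup_setOf_coe_eq (by linarith) (fun _ ↦ h.le_of_frequently_distInt_le hlam)
    fun _ hμ₀ ↦ h.frequently_distInt_le hu hμ₀.le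

end HasGaps

/-- The positions `t` of the gaps of a number with exponent `α`, and the positions `s` of the gaps
of numbers with exponents in `[w, L]`: the gap after `t i` extends to about `w * s i`, and
`t (i + 1)` comes after the end of the gap at `s i`. -/
structure Interlaced (α L w : ℝ) (t s : ℕ → ℕ) : Prop where
  one_le : 1 ≤ w
  le_left : w ≤ α
  left_le : α ≤ L
  mul_left_le : ∀ i, α * t i ≤ w * s i
  mul_right_le : ∀ i, w * s i ≤ α * t i + w
  gap_lt : ∀ i, L * s i + 2 < t (i + 1)

lemma exists_interlaced {α L w : ℝ} (hw : 1 ≤ w) (hwα : w ≤ α) (hαL : α ≤ L) :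
    ∃ t s : ℕ → ℕ, Interlaced α L w t s := by
  obtain ⟨M, hM⟩ := exists_nat_gt (L * (L + 1) + 2)
  have hw₀ : 0 < w := by linarith
  have hα : 0 < α := by linarith
  have hL : 0 < L := by linarith
  have hM₁ : (1 : ℝ) ≤ M := by nlinarith
  have hceil (i : ℕ) : (⌈α * (M ^ i : ℕ) / w⌉₊ : ℝ) ≤ α * (M ^ i : ℕ) / w + 1 :=
    (Nat.ceil_lt_add_one (by positivity)).le
  refine ⟨fun i ↦ M ^ i, fun i ↦ ⌈α * (M ^ i : ℕ) / w⌉₊, hw, hwα, hαL,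
    fun i ↦ ?_, fun i ↦ ?_, fun i ↦ ?_⟩
  · rw [← div_le_iff₀' hw₀]
    exact Nat.le_ceil _
  · calc w * ⌈α * (M ^ i : ℕ) / w⌉₊ ≤ w * (α * (M ^ i : ℕ) / w + 1) := by gcongr; exact hceil i
      _ = α * (M ^ i : ℕ) + w := by field_simp
  · have ht : (1 : ℝ) ≤ (M ^ i : ℕ) := by exact_mod_cast one_le_pow₀ hM₁
    have hs : (⌈α * (M ^ i : ℕ) / w⌉₊ : ℝ) ≤ (L + 1) * (M ^ i : ℕ) := by
      have : α * (M ^ i : ℕ) / w ≤ L * (M ^ i : ℕ) :=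
        (div_le_self (by positivity) hw).trans (by gcongr)
      linarith [hceil i]
    calc L * ⌈α * (M ^ i : ℕ) / w⌉₊ + 2 ≤ L * ((L + 1) * (M ^ i : ℕ)) + 2 * (M ^ i : ℕ) := by
          gcongr; linarith
      _ = (L * (L + 1) + 2) * (M ^ i : ℕ) := by ring
      _ < M * (M ^ i : ℕ) := by gcongr
      _ = (M ^ (i + 1) : ℕ) := by push_cast; ring

namespace Interlaced

variable {α L w : ℝ} {t s : ℕ → ℕ} (h : Interlaced α L w t s)

include h

lemma left_le_right (i : ℕ) : t i ≤ s i := by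
  have hw : 0 < w := zero_lt_one.trans_le h.one_le
  refine Nat.cast_le (α := ℝ).1 (le_of_mul_le_mul_left (le_trans ?_ (h.mul_left_le i)) hw)
  gcongr
  exact h.le_left

lemma isSparse_left {l : ℝ} (hl : l ≤ L) : IsSparse l t := fun i ↦ by
  have hL : 0 ≤ L := by linarith [h.one_le, h.le_left, h.left_le]
  have hle : l * t i ≤ L * s i := by gcongr; exact h.left_le_right i
  linarith [h.gap_lt i]

lemma isSparse_right {l : ℝ} (hl : l ≤ L) : IsSparse l s := fun i ↦ by
  have hle : l * s i ≤ L * s i := by gcongr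
  have hle' : (t (i + 1) : ℝ) ≤ s (i + 1) := Nat.cast_le.2 (h.left_le_right _)
  linarith [h.gap_lt i]

lemma strictMono_left : StrictMono t :=
  (h.isSparse_left (h.le_left.trans h.left_le)).strictMono h.one_le

lemma strictMono_right : StrictMono s :=
  (h.isSparse_right (h.le_left.trans h.left_le)).strictMono h.one_le

variable {k : ℕ} {lam : Fin k → ℝ} {ζ : Fin k → ℝ} {i₀ : Fin k}

lemma le_of_mem_chiSet {i₁ : Fin k} (hL : lam i₁ ≤ L) (h₀ : HasGaps α t (ζ i₀))
    (h₁ : HasGaps (lam i₁) s (ζ i₁)) {ν : ℝ} (hν : ζ ∈ chiSet k fun X ↦ X ^ (-ν)) : ν ≤ w := by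
  by_contra! hlt
  have hw := h.one_le
  obtain ⟨X, ⟨x, hx⟩, hX⟩ := (hν.and_eventually
    (eventually_lt_mul_logb (b := 8) (by norm_num) (sub_pos.2 hlt) 2)).exists
  have hgap {l : ℝ} {u : ℕ → ℕ} (j : Fin k) (hj : HasGaps l u (ζ j)) :
      ∃ i, u i ≤ Real.logb 8 X ∧ ν * Real.logb 8 X ≤ l * u i + 2 := by
    obtain ⟨hx₀, hxX, hd⟩ := hx j
    have hlog : 0 < Real.logb 8 X := pos_of_mul_pos_right (by linarith) (sub_nonneg.2 hlt.le)
    have hX' : 2 < (ν - 1) * Real.logb 8 X := hX.trans_le (by gcongr)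
    exact hj.exists_of_distInt_le hX' (abs_pos.1 hx₀) hxX hd
  obtain ⟨a, ha, hνa⟩ := hgap i₀ h₀
  obtain ⟨b, hb, hνb⟩ := hgap i₁ h₁
  obtain hab | hba := le_or_gt a b
  · have hs : (s a : ℝ) ≤ Real.logb 8 X :=
      (Nat.cast_le.2 (h.strictMono_right.monotone hab)).trans hb
    have := mul_le_mul_of_nonneg_left hs (zero_le_one.trans hw)
    linarith [h.mul_left_le a]
  · have ht : (t (b + 1) : ℝ) ≤ Real.logb 8 X :=
      (Nat.cast_le.2 (h.strictMono_left.monotone hba)).trans ha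
    have hL' : lam i₁ * s b ≤ L * s b := by gcongr
    have : Real.logb 8 X ≤ ν * Real.logb 8 X :=
      le_mul_of_one_le_left ((Nat.cast_nonneg _).trans ha) (hw.trans hlt.le)
    linarith [h.gap_lt b]

lemma mem_chiSet (hwlam : ∀ j, w ≤ lam j) (h₀ : HasGaps α t (ζ i₀))
    (h₁ : ∀ j ≠ i₀, HasGaps (lam j) s (ζ j)) {ν : ℝ} (hν : ν < w) :
    ζ ∈ chiSet k fun X ↦ X ^ (-ν) := by
  have hX : Tendsto (fun i ↦ (8 : ℝ) ^ (s i + 1)) atTop atTop :=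
    (tendsto_pow_atTop_atTop_of_one_lt (by norm_num)).comp
      ((tendsto_add_atTop_nat 1).comp h.strictMono_right.tendsto_atTop)
  refine hX.frequently (Eventually.frequently ?_)
  filter_upwards [eventually_le_mul_natCast h.strictMono_right (sub_pos.2 hν) (ν + w + 1)]
    with i hi
  have hex (j : Fin k) : ∃ x : ℕ, 0 < x ∧ x ≤ 8 ^ (s i + 1) ∧
      distInt (x * ζ j) ≤ ((8 : ℝ) ^ (s i + 1)) ^ (-ν) := by
    by_cases hj : j = i₀
    · obtain ⟨x, hlow, hx⟩ := (hj ▸ h₀).exists_distInt_le_rpow (ν := ν) (a := s i + 1) (i := i)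
        (Nat.lt_succ_of_le (h.left_le_right i))
        (by push_cast; linarith [h.mul_right_le i])
      exact ⟨x, (by positivity : 0 < 8 ^ t i).trans_le hlow, hx⟩
    · have hle : w * s i ≤ lam j * s i := by gcongr; exact hwlam j
      obtain ⟨x, hlow, hx⟩ := (h₁ j hj).exists_distInt_le_rpow (ν := ν) (s i).lt_succ_self
        (by push_cast; linarith [h.one_le])
      exact ⟨x, (by positivity : 0 < 8 ^ s i).trans_le hlow, hx⟩
  choose x hpos hle hd using hex
  refine ⟨fun j ↦ x j, fun j ↦
    ⟨abs_pos.2 (Int.natCast_ne_zero.2 (hpos j).ne'), ?_, by exact_mod_cast hd j⟩⟩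
  simpa using (by exact_mod_cast hle j : (x j : ℝ) ≤ 8 ^ (s i + 1))

theorem chiExponent_eq {i₁ : Fin k} (hi : i₁ ≠ i₀) (hL : lam i₁ ≤ L) (hwlam : ∀ j, w ≤ lam j)
    (h₀ : HasGaps α t (ζ i₀)) (h₁ : ∀ j ≠ i₀, HasGaps (lam j) s (ζ j)) :
    chiExponent k ζ = w :=
  sSup_setOf_coe_eq (zero_lt_one.trans_le h.one_le)
    (fun _ hν ↦ h.le_of_mem_chiSet hL h₀ (h₁ i₁ hi) hν.2)
    fun _ hν₀ hν ↦ ⟨hν₀, h.mem_chiSet hwlam h₀ h₁ hν⟩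

end Interlaced

/-! ### Linear independence -/

lemma snoc_mem_of_forall_mem {V : Type*} {n : ℕ} {F : Fin (n + 1) → Set V} {ζ : Fin n → V} {y : V}
    (hζ : ∀ j, ζ j ∈ F j.castSucc) (hy : y ∈ F (Fin.last n)) (j : Fin (n + 1)) :
    (Fin.snoc ζ y : Fin (n + 1) → V) j ∈ F j := by
  induction j using Fin.lastCases with
  | last => simpa using hy
  | cast j => simpa using hζ j

section LinearIndependence

variable {K V : Type*} [DivisionRing K] [AddCommGroup V] [Module K V] {v : V}

lemma linearIndependent_cons_snoc {n : ℕ} {ζ : Fin n → V} {y : V}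
    (hζ : LinearIndependent K (Fin.cons v ζ : Fin (n + 1) → V))
    (hy : y ∉ Submodule.span K (Set.range (Fin.cons v ζ : Fin (n + 1) → V))) :
    LinearIndependent K (Fin.cons v (Fin.snoc ζ y : Fin (n + 1) → V) : Fin (n + 2) → V) := by
  rw [Fin.cons_snoc_eq_snoc_cons]
  exact linearIndependent_finSnoc.2 ⟨hζ, hy⟩

variable (K) [Countable K]

lemma not_countable_diff_span {ι : Type*} [Countable ι] {F : Set V} (hF : ¬ F.Countable)
    (b : ι → V) : ¬ (F \ Submodule.span K (Set.range b)).Countable :=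
  fun h ↦ hF (h.of_sdiff (Set.countable_coe_iff.1
    (inferInstanceAs (Countable (Submodule.span K (Set.range b))))))

lemma exists_linearIndependent_cons (hv : v ≠ 0) {n : ℕ} (F : Fin n → Set V)
    (hF : ∀ j, ¬ (F j).Countable) :
    ∃ ζ : Fin n → V, LinearIndependent K (Fin.cons v ζ : Fin (n + 1) → V) ∧ ∀ j, ζ j ∈ F j := by
  induction n with
  | zero =>
    exact ⟨Fin.elim0, linearIndependent_finCons.2 ⟨linearIndependent_empty_type, by simpa⟩,
      fun j ↦ j.elim0⟩
  | succ n ih =>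
    obtain ⟨ζ, hind, hζ⟩ := ih (fun j ↦ F j.castSucc) fun j ↦ hF _
    obtain ⟨y, hy, hyspan⟩ := Set.Infinite.nonempty <| mt Set.Finite.countable <|
      not_countable_diff_span K (hF (Fin.last n)) (Fin.cons v ζ : Fin (n + 1) → V)
    exact ⟨Fin.snoc ζ y, linearIndependent_cons_snoc hind hyspan, snoc_mem_of_forall_mem hζ hy⟩

theorem not_countable_setOf_linearIndependent_cons (hv : v ≠ 0) {n : ℕ} (F : Fin (n + 1) → Set V)
    (hF : ∀ j, ¬ (F j).Countable) :
    ¬ {ζ : Fin (n + 1) → V | LinearIndependent K (Fin.cons v ζ : Fin (n + 2) → V) ∧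
      ∀ j, ζ j ∈ F j}.Countable := by
  obtain ⟨ζ, hind, hζ⟩ := exists_linearIndependent_cons K hv (fun j ↦ F j.castSucc)
    fun j ↦ hF _
  have hinj : Function.Injective fun y : V ↦ (Fin.snoc ζ y : Fin (n + 1) → V) :=
    Fin.snoc_right_injective (α := fun _ ↦ V) ζ
  refine fun hc ↦ not_countable_diff_span K (hF (Fin.last n))
    (Fin.cons v ζ : Fin (n + 1) → V) ((hc.preimage hinj).mono ?_)
  exact fun y hy ↦ ⟨linearIndependent_cons_snoc hind hy.2, snoc_mem_of_forall_mem hζ hy.1⟩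

end LinearIndependence

theorem mainTheorem4 (k : ℕ) (hk : 2 ≤ k) (lam : Fin k → ℝ) (w : ℝ)
    (hw : 1 ≤ w) (hwlam : ∀ j, w ≤ lam j) :
    ¬ Set.Countable {ζ : Fin k → ℝ |
      LinearIndependent ℚ (Fin.cons 1 ζ : Fin (k + 1) → ℝ) ∧
      (∀ j, lambdaOne (ζ j) = (lam j : EReal)) ∧
      chiExponent k ζ = (w : EReal)} := by
  obtain ⟨k, rfl⟩ := Nat.exists_eq_add_of_le' hk
  obtain ⟨L, hL⟩ := (Set.finite_range lam).bddAbove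
  replace hL (j : Fin (k + 2)) : lam j ≤ L := hL ⟨j, rfl⟩
  have hlam (j : Fin (k + 2)) : 1 ≤ lam j := hw.trans (hwlam j)
  obtain ⟨t, s, h⟩ := exists_interlaced hw (hwlam 0) (hL 0)
  let u (j : Fin (k + 2)) : ℕ → ℕ := if j = 0 then t else s
  have hu (j : Fin (k + 2)) : IsSparse (lam j) (u j) := by
    by_cases hj : j = 0
    · simpa only [u, if_pos hj] using h.isSparse_left (hL j)
    · simpa only [u, if_neg hj] using h.isSparse_right (hL j)
  refine fun hc ↦ not_countable_setOf_linearIndependent_cons ℚ one_ne_zero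
    (fun j ↦ {z | HasGaps (lam j) (u j) z}) (fun j ↦ not_countable_setOf_hasGaps (hlam j) (hu j))
    (hc.mono ?_)
  rintro ζ ⟨hind, hζ⟩
  refine ⟨hind, fun j ↦ (hζ j).lambdaOne_eq (hlam j) ((hu j).strictMono (hlam j)), ?_⟩
  exact h.chiExponent_eq one_ne_zero (hL 1) hwlam (hζ 0) fun j hj ↦ by
    simpa only [u, if_neg hj, Set.mem_ofPred_eq] using hζ j
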